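/- Write $a^b=b^{-1}ab$. Let $G=\langle x,y,t\mid x^y=x^2,\ x^t=y\rangle$ be the Baumslag–Gersten group, and let $H=\langle x,y\mid x^y=x^2\rangle$ be the Baumslag–Solitar group, regarded as the subgroup $\langle x,y\rangle$ of $G$ via the natural homomorphism $H\to G$, $x\mapsto x$, $y\mapsto y$. Let $C_H(x)$ be the centraliser of $x$ in $H$. Let $F:G\to G$ be a homomorphism. (1) If $F(x)=1$, then $F(y)=1$, and $F(t)$ can be any element of $G$: for every $w\in G$ there is a homomorphism $F:G\to G$ with $F(x)=1$, $F(y)=1$ and $F(t)=w$. (2) If $F(x)\neq 1$, then $F$ is an automorphism of $G$, and there exist an inner automorphism $A$ of $G$ and an element $g\in C_H(x)$ such that $(A\circ F)(x)=x$, $(A\circ F)(y)=y$ and $(A\circ F)(t)=gt$. -/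

import Mathlib

namespace BaumslagGersten

/-- The exponential notation `a ^ b = b⁻¹ a b` for conjugation, as a function. -/
def conjBy {K : Type*} [Group K] (a b : K) : K := b⁻¹ * a * b

/-- The relator of `H`, with generators `x = of 0`, `y = of 1`: the relation `x ^ y = x ^ 2`. -/
def relsH : Set (FreeGroup (Fin 2)) :=
  {conjBy (FreeGroup.of 0) (FreeGroup.of 1) * (FreeGroup.of 0 ^ 2)⁻¹}

/-- The Baumslag–Solitar group `H = ⟨x, y | x ^ y = x ^ 2⟩`. -/
abbrev H : Type := PresentedGroup relsH

namespace H

/-- The generator `x` of `H`. -/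
def x : H := PresentedGroup.of 0

/-- The generator `y` of `H`. -/
def y : H := PresentedGroup.of 1

end H

/-- The relators of `G`, with generators `x = of 0`, `y = of 1`, `t = of 2`:
the relations `x ^ y = x ^ 2` and `x ^ t = y`. -/
def relsG : Set (FreeGroup (Fin 3)) :=
  {conjBy (FreeGroup.of 0) (FreeGroup.of 1) * (FreeGroup.of 0 ^ 2)⁻¹,
   conjBy (FreeGroup.of 0) (FreeGroup.of 2) * (FreeGroup.of 1)⁻¹}

/-- The Baumslag–Gersten group `G = ⟨x, y, t | x ^ y = x ^ 2, x ^ t = y⟩`. -/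
abbrev G : Type := PresentedGroup relsG

namespace G

/-- The generator `x` of `G`. -/
def x : G := PresentedGroup.of 0

/-- The generator `y` of `G`. -/
def y : G := PresentedGroup.of 1

/-- The generator `t` of `G`. -/
def t : G := PresentedGroup.of 2

theorem conjBy_x_y : conjBy x y = x ^ 2 :=
  PresentedGroup.mk_eq_mk_of_mul_inv_mem (rels := relsG) (Set.mem_insert _ _)

end G

theorem lift_relsH : ∀ r ∈ relsH, FreeGroup.lift ![G.x, G.y] r = 1 := by
  intro r hr
  rw [Set.mem_singleton_iff.mp hr]
  have h := G.conjBy_x_y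
  simp only [conjBy] at h
  simp [conjBy, h]

/-- The natural homomorphism `H → G`, `x ↦ x`, `y ↦ y`, through which `H` is regarded as the
subgroup `⟨x, y⟩` of `G`. -/
def incl : H →* G := PresentedGroup.toGroup lift_relsH

theorem incl_x : incl H.x = G.x := PresentedGroup.toGroup.of lift_relsH

theorem incl_y : incl H.y = G.y := PresentedGroup.toGroup.of lift_relsH

end BaumslagGersten

/-!
The group `G` is the HNN extension of `H` in which the stable letter `t` conjugates the infinite
cyclic subgroup `⟨y⟩` to `⟨x⟩` (`G.equivE`), so Britton's lemma applies. An endomorphism `F` is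
given by `a = F x`, `b = F y`, `c = F t` with `a ^ b = a ^ 2` and `a ^ c = b`, and the claim is
that if `a ≠ 1` then `(a, b, c)` is conjugate to `(x, y, g * t)` with `g` in the centraliser of `x`.

* `a` is conjugate into `H`. Otherwise it is conjugate to a nonempty cyclically reduced word, and
  then `a ^ (2 ^ k)` has at least `2 ^ k - O(1)` stable letters, while
  `a ^ (2 ^ k) = b ^ (-k) * a * b ^ k` has only `O(k)`
  (`HNNExtension.exists_isConj_of_of_conj_eq_sq`).
* Let `deg` be the exponent sum of `y` on `H`. If two words `p * g` and `g * q` agree, with `p, q`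
  in `H` and `g` reduced, then comparing heads peels off the first stable letter of `g`
  (`HNNExtension.exists_of_mul_syl_eq`). Hence an element conjugating a nontrivial degree-zero
  element of `H` into `H` contains at most one stable letter (`E.exists_of_mul_eq`). It follows
  that `a` and `b` can be conjugated into `H` simultaneously (`E.exists_conj_mem`).
* Inside `H` every element is `y ^ i * x ^ m * y ^ (-j)`, which gives that `a` has degree zero and
  that `b` is conjugate to `y` (`H.deg_eq_and_isConj_y`). With `b = y`, the equation `a ^ c = y`
  forces `c = p * t * y ^ n` with `a = p * x * p⁻¹`, so that conjugation by a power of `y`, which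
  fixes `b`, takes `a` to `x` (`E.exists_conj_eq`).

An endomorphism with `x ↦ x`, `y ↦ y`, `t ↦ g * t` has the inverse `t ↦ g⁻¹ * t`
(`G.bijective_of_eq`).
-/

/-! ### Reduced words and length in HNN extensions -/

namespace HNNExtension

open NormalWord

variable {K : Type*} [Group K] {A B : Subgroup K} {φ : A ≃* B}

variable (A B) in
/-- The condition on consecutive syllables `t ^ u * k`, `t ^ v * l` of a reduced word. -/
def Rel (p q : ℤˣ × K) : Prop := p.2 ∈ toSubgroup A B p.1 → p.1 = q.1

variable (φ) in
/-- The product of a list of syllables, where `(u, k)` stands for `t ^ u * k`. -/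
def syl (L : List (ℤˣ × K)) : HNNExtension K A B φ :=
  (L.map fun p => t ^ (p.1 : ℤ) * of p.2).prod

@[simp] theorem syl_nil : syl φ [] = 1 := rfl

@[simp] theorem syl_cons (p : ℤˣ × K) (L : List (ℤˣ × K)) :
    syl φ (p :: L) = t ^ (p.1 : ℤ) * of p.2 * syl φ L := by
  simp [syl]

@[simp] theorem syl_append (L M : List (ℤˣ × K)) :
    syl φ (L ++ M) = syl φ L * syl φ M := by
  simp [syl]

theorem syl_flatten_replicate (L : List (ℤˣ × K)) (n : ℕ) :
    syl φ (List.replicate n L).flatten = syl φ L ^ n := by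
  induction n with
  | zero => simp
  | succ n ih => simp [List.replicate_succ, pow_succ', ih]

theorem zpow_mul_of (u : ℤˣ) (a : toSubgroup A B u) :
    (t ^ (u : ℤ) * of (a : K) : HNNExtension K A B φ) =
      of (toSubgroupEquiv φ u a : K) * t ^ (u : ℤ) := by
  rcases Int.units_eq_one_or u with rfl | rfl
  · rw [Units.val_one, zpow_one]
    exact t_mul_of (φ := φ) a
  · rw [Units.val_neg, Units.val_one, zpow_neg_one]
    exact inv_t_mul_of (φ := φ) a

/-- Every element is the product of a reduced word. -/
theorem exists_reduced (g : HNNExtension K A B φ) :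
    ∃ (k : K) (L : List (ℤˣ × K)), L.IsChain (Rel A B) ∧ g = of k * syl φ L := by
  obtain ⟨d⟩ := TransversalPair.nonempty K A B
  obtain ⟨w, rfl⟩ := (equiv φ d).symm.surjective g
  exact ⟨w.head, w.toList, w.chain, rfl⟩

/-- Two reduced words with the same product have the same pattern of stable letters, and
their heads lie in the same coset. -/
theorem reduced_unique {k k' : K} {L L' : List (ℤˣ × K)} (hL : L.IsChain (Rel A B))
    (hL' : L'.IsChain (Rel A B)) (h : of k * syl φ L = of k' * syl φ L') :
    L.map Prod.fst = L'.map Prod.fst ∧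
      ∀ u ∈ L.head?.map Prod.fst, k⁻¹ * k' ∈ toSubgroup A B (-u) :=
  ReducedWord.map_fst_eq_and_of_prod_eq φ
    (w₁ := ⟨k, L, hL⟩) (w₂ := ⟨k', L', hL'⟩) h

/-- The number of stable letters in a reduced word representing `g`. -/
noncomputable def len (g : HNNExtension K A B φ) : ℕ :=
  (exists_reduced g).choose_spec.choose.length

theorem len_eq {k : K} {L : List (ℤˣ × K)} (hL : L.IsChain (Rel A B)) :
    len (of k * syl φ L) = L.length := by
  have h := (exists_reduced (of k * syl φ L)).choose_spec.choose_spec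
  have := congrArg List.length (reduced_unique hL h.1 h.2).1
  rw [List.length_map, List.length_map] at this
  exact this.symm

theorem len_of_mul (k : K) (g : HNNExtension K A B φ) : len (of k * g) = len g := by
  obtain ⟨l, L, hL, rfl⟩ := exists_reduced g
  rw [← mul_assoc, ← map_mul, len_eq hL, len_eq hL]

theorem len_t_mul (g : HNNExtension K A B φ) :
    len (t * g) ≤ 1 + len g ∧ len g ≤ 1 + len (t * g) := by
  obtain ⟨k, L, hL, rfl⟩ := exists_reduced g
  by_cases hc : ((1, k) :: L).IsChain (Rel A B)
  · have h := len_eq (φ := φ) (k := 1) hc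
    simp only [map_one, one_mul, syl_cons, Units.val_one, zpow_one, List.length_cons,
      mul_assoc] at h
    rw [h, len_eq hL]
    omega
  · match L, hL, hc with
    | [], _, hc => exact absurd (List.isChain_singleton _) hc
    | (v, l) :: M, hL, hc =>
      have hc' : ¬ Rel A B (1, k) (v, l) := fun h => hc (List.isChain_cons_cons.2 ⟨h, hL⟩)
      simp only [Rel, toSubgroup_one, Classical.not_imp] at hc'
      obtain ⟨hk, hv⟩ := hc'
      obtain rfl : v = -1 := (Int.units_eq_one_or v).resolve_left (Ne.symm hv)
      have key : (t * (of k * syl φ ((-1, l) :: M)) : HNNExtension K A B φ) =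
          of ((φ ⟨k, hk⟩ : K) * l) * syl φ M := by
        have := t_mul_of (φ := φ) ⟨k, hk⟩
        simp only at this
        rw [← mul_assoc, this]
        simp [mul_assoc]
      rw [key, len_eq hL, len_eq (List.isChain_cons.1 hL).2]
      simp only [List.length_cons]
      omega

/-- Left multiplication by a fixed element changes the length by a bounded amount. -/
theorem exists_len_mul_le (g : HNNExtension K A B φ) :
    ∃ C, ∀ h, len (g * h) ≤ C + len h ∧ len h ≤ C + len (g * h) := by
  induction g using induction_on with
  | of k => exact ⟨0, fun h => by simp [len_of_mul]⟩
  | t => exact ⟨1, len_t_mul⟩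
  | mul x y hx hy =>
    obtain ⟨C, hC⟩ := hx
    obtain ⟨D, hD⟩ := hy
    refine ⟨C + D, fun h => ?_⟩
    have h1 := hC (y * h)
    have h2 := hD h
    rw [mul_assoc]
    omega
  | inv x hx =>
    obtain ⟨C, hC⟩ := hx
    refine ⟨C, fun h => ?_⟩
    have h1 := hC (x⁻¹ * h)
    rw [mul_inv_cancel_left] at h1
    exact h1.symm

/-- The last syllable of a nonempty reduced word absorbs a factor from the base group. -/
theorem exists_syl_mul_of (k : K) {L : List (ℤˣ × K)} (hL : L.IsChain (Rel A B))
    (hne : L ≠ []) :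
    ∃ L' : List (ℤˣ × K), L'.IsChain (Rel A B) ∧ L'.length = L.length ∧
      syl φ L' = syl φ L * of k := by
  obtain ⟨M, ⟨u, l⟩, rfl⟩ := (List.eq_nil_or_concat L).resolve_left hne
  rw [List.concat_eq_append, List.isChain_append] at *
  refine ⟨M ++ [(u, l * k)], List.isChain_append.2 ⟨hL.1, List.isChain_singleton _, ?_⟩, ?_, ?_⟩
  · intro p hp q hq
    simp only [List.head?_cons, Option.mem_def, Option.some.injEq] at hq
    subst hq
    exact hL.2.2 p hp (u, l) rfl
  · simp
  · simp [mul_assoc]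

/-! ### Cyclic reduction and elements conjugate to their square -/

/-- A reduced list of syllables is cyclically reduced if it stays reduced when repeated. -/
def CycRed (A B : Subgroup K) (L : List (ℤˣ × K)) : Prop :=
  L.IsChain (Rel A B) ∧ ∀ p ∈ L.getLast?, ∀ q ∈ L.head?, Rel A B p q

theorem CycRed.isChain_flatten {L : List (ℤˣ × K)} (hL : CycRed A B L) (hne : L ≠ []) (n : ℕ) :
    (List.replicate n L).flatten.IsChain (Rel A B) := by
  induction n with
  | zero => simp
  | succ n ih =>
    rw [List.replicate_succ, List.flatten_cons, List.isChain_append]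
    refine ⟨hL.1, ih, fun p hp q hq => hL.2 p hp q ?_⟩
    cases n with
    | zero => simp at hq
    | succ n =>
      rwa [List.replicate_succ, List.flatten_cons, List.head?_append_of_ne_nil _ hne] at hq

/-- Every element is conjugate either into the base group or to the product of a nonempty
cyclically reduced word. -/
theorem isConj_of_or_cycRed (g : HNNExtension K A B φ) :
    (∃ k : K, IsConj g (of k)) ∨
      ∃ L : List (ℤˣ × K), L ≠ [] ∧ CycRed A B L ∧ IsConj g (syl φ L) := by
  induction hn : len g using Nat.strong_induction_on generalizing g with
  | _ n ih =>
    obtain ⟨k, L, hL, rfl⟩ := exists_reduced g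
    rw [len_eq hL] at hn
    by_cases hne : L = []
    · subst hne
      exact .inl ⟨k, by simpa using IsConj.refl (of k : HNNExtension K A B φ)⟩
    obtain ⟨L', hL', hlen, hprod⟩ := exists_syl_mul_of (φ := φ) k hL hne
    have hconj : IsConj (of k * syl φ L) (syl φ L') := by
      rw [hprod]
      exact isConj_iff.2 ⟨(of k)⁻¹, by simp⟩
    have hne' : L' ≠ [] := by
      rintro rfl
      exact hne (List.length_eq_zero_iff.1 hlen.symm)
    -- if the last syllable does not cancel against the first one, the word is cyclically
    -- reduced; otherwise rotating it to the front yields a shorter word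
    by_cases hc : CycRed A B L'
    · exact .inr ⟨L', hne', hc, hconj⟩
    have hc2 : ∃ p ∈ L'.getLast?, ∃ q ∈ L'.head?, ¬ Rel A B p q := by
      by_contra! h
      exact hc ⟨hL', h⟩
    obtain ⟨⟨u, l⟩, hp, ⟨v, m⟩, hq, hR⟩ := hc2
    simp only [Rel, Classical.not_imp] at hR
    obtain ⟨hl, huv⟩ := hR
    obtain ⟨M, rfl⟩ : ∃ M, L' = (v, m) :: M := by
      cases L' with
      | nil => simp at hq
      | cons a M => exact ⟨M, by simpa using hq⟩
    have hM : M ≠ [] := by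
      rintro rfl
      simp only [List.getLast?_singleton, Option.mem_def, Option.some.injEq, Prod.mk.injEq] at hp
      exact huv hp.1.symm
    obtain ⟨N, r, rfl⟩ := (List.eq_nil_or_concat M).resolve_left hM
    rw [List.concat_eq_append] at *
    obtain rfl : r = (u, l) := by
      rw [← List.cons_append, List.getLast?_append] at hp
      simpa using hp
    have hN : N.IsChain (Rel A B) :=
      (List.isChain_append.1 (List.isChain_cons.1 hL').2).1
    obtain rfl : v = -u := Int.units_ne_iff_eq_neg.1 (Ne.symm huv)
    set g' : HNNExtension K A B φ := of ((toSubgroupEquiv φ u ⟨l, hl⟩ : K) * m) * syl φ N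
      with hg'
    have hconj' : IsConj (syl φ ((-u, m) :: (N ++ [(u, l)]))) g' := by
      refine isConj_iff.2 ⟨t ^ (u : ℤ) * of l, ?_⟩
      have := zpow_mul_of (φ := φ) u ⟨l, hl⟩
      simp only at this
      rw [hg', this]
      simp only [syl_cons, syl_append, Units.val_neg, zpow_neg, map_mul, syl_nil, mul_one]
      rw [this]
      group
    have hlt : len g' < n := by
      rw [hg', len_eq hN, ← hn, ← hlen]
      simp only [List.length_cons, List.length_append, List.length_nil]
      omega
    rcases ih _ hlt g' rfl with ⟨k', hk'⟩ | ⟨L'', h1, h2, h3⟩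
    · exact .inl ⟨k', (hconj.trans hconj').trans hk'⟩
    · exact .inr ⟨L'', h1, h2, (hconj.trans hconj').trans h3⟩

/-- An element conjugate to its own square is conjugate into the base group: the powers
`a ^ (2 ^ k)` of a cyclically reduced word have length at least `2 ^ k`, whereas
`b ^ (-k) * a * b ^ k` has length linear in `k`. -/
theorem exists_isConj_of_of_conj_eq_sq {a b : HNNExtension K A B φ} (h : b⁻¹ * a * b = a ^ 2) :
    ∃ k : K, IsConj a (of k) := by
  refine (isConj_of_or_cycRed a).resolve_right ?_
  rintro ⟨L, hne, hL, hconj⟩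
  obtain ⟨w, hw⟩ := isConj_iff.1 hconj
  set c := w * b * w⁻¹ with hc
  have hcs : c⁻¹ * syl φ L * c = syl φ L ^ 2 := by
    rw [← hw, hc, conj_pow, ← h]
    group
  have hpow (k : ℕ) : c⁻¹ ^ k * syl φ L * c ^ k = syl φ L ^ 2 ^ k := by
    induction k with
    | zero => simp
    | succ k ih =>
      calc c⁻¹ ^ (k + 1) * syl φ L * c ^ (k + 1)
          = c⁻¹ * (c⁻¹ ^ k * syl φ L * c ^ k) * c := by
            rw [pow_succ', pow_succ]; simp only [mul_assoc]
        _ = (c⁻¹ * syl φ L * c) ^ 2 ^ k := by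
            rw [ih]
            simpa using (conj_pow (i := 2 ^ k) (a := c⁻¹) (b := syl φ L)).symm
        _ = _ := by rw [hcs, ← pow_mul, pow_succ']
  have hlen (k : ℕ) : 2 ^ k ≤ len (c⁻¹ ^ k * syl φ L * c ^ k) := by
    have := len_eq (φ := φ) (k := 1) (hL.isChain_flatten hne (2 ^ k))
    rw [map_one, one_mul, syl_flatten_replicate] at this
    rw [hpow, this]
    simpa using Nat.le_mul_of_pos_right (2 ^ k) (List.length_pos_iff.2 hne)
  obtain ⟨C, hC⟩ := exists_len_mul_le c
  obtain ⟨D, hD⟩ := exists_len_mul_le c⁻¹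
  obtain ⟨E, hE⟩ := exists_len_mul_le (syl φ L)
  have hup (C : ℕ) (g : HNNExtension K A B φ) (hC : ∀ h, len (g * h) ≤ C + len h) (k : ℕ)
      (h : HNNExtension K A B φ) : len (g ^ k * h) ≤ k * C + len h := by
    induction k with
    | zero => simp
    | succ k ih =>
      have := hC (g ^ k * h)
      rw [pow_succ', mul_assoc]
      linarith
  have hbound (k : ℕ) : 2 ^ k ≤ k * (C + D) + (E + len (1 : HNNExtension K A B φ)) := by
    have h1 := hup D c⁻¹ (fun h => (hD h).1) k (syl φ L * (c ^ k * 1))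
    have h2 := (hE (c ^ k * 1)).1
    have h3 := hup C c (fun h => (hC h).1) k 1
    have h4 := hlen k
    rw [mul_one] at h1 h2 h3
    rw [mul_assoc] at h4
    linarith
  -- exponential growth beats linear growth
  generalize C + D = S at hbound
  generalize E + len (1 : HNNExtension K A B φ) = T at hbound
  have h1 := hbound (3 * (S + T + 3))
  have h2 : S + T + 3 ≤ 2 ^ (S + T + 3) := Nat.lt_two_pow_self.le
  have h3 := Nat.pow_le_pow_left h2 3
  rw [← pow_mul, mul_comm _ 3] at h3
  have h4 : (S + T + 3) ^ 3 = 3 * (S + T + 3) * S + T +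
      (S ^ 3 + 3 * S ^ 2 * T + 3 * S * T ^ 2 + T ^ 3 + 6 * S ^ 2 + 15 * S * T + 9 * T ^ 2 +
        18 * S + 26 * T + 27) := by ring
  omega

end HNNExtension

/-! ### Conjugation within the base group -/

namespace HNNExtension

variable {K : Type*} [Group K] {A B : Subgroup K} {φ : A ≃* B}

/-- Suppose `g = k * t ^ u * l * ⋯` is reduced and conjugates `a` in the base group to `a'` in the
base group. Since `a * g = g * a'` are two reduced words for the same element, `k⁻¹ * a * k` lies
in an associated subgroup, and the rest of the word conjugates its image under `t ^ u` to `a'`. -/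
theorem exists_of_mul_syl_eq {a a' k l : K} {u : ℤˣ} {L : List (ℤˣ × K)}
    (hL : ((u, l) :: L).IsChain (Rel A B))
    (h : (of a * (of k * syl φ ((u, l) :: L)) : HNNExtension K A B φ) =
      of k * syl φ ((u, l) :: L) * of a') :
    ∃ s : toSubgroup A B (-u), k⁻¹ * a * k = s ∧
      of (toSubgroupEquiv φ (-u) s : K) * (of l * syl φ L) = of l * syl φ L * of a' := by
  obtain ⟨M, hM, -, hprod⟩ := exists_syl_mul_of (φ := φ) a'⁻¹ hL (List.cons_ne_nil _ _)
  have heq : (of k * syl φ ((u, l) :: L) : HNNExtension K A B φ) = of (a * k) * syl φ M := by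
    rw [hprod, map_mul, mul_assoc, ← mul_assoc (of k), ← mul_assoc (of a), h]
    simp
  have hmem := (reduced_unique hL hM heq).2 u (by simp)
  refine ⟨⟨k⁻¹ * a * k, by rwa [mul_assoc]⟩, rfl, ?_⟩
  have hz := zpow_mul_of (φ := φ) (-u) ⟨k⁻¹ * a * k, by rwa [mul_assoc]⟩
  rw [← mul_inv_eq_iff_eq_mul] at hz
  rw [← hz]
  simp only [syl_cons, Units.val_neg, zpow_neg, inv_inv, map_mul, map_inv] at h ⊢
  have h' := congrArg (fun z => (t ^ (u : ℤ))⁻¹ * (of k)⁻¹ * z) h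
  simp only [mul_assoc, inv_mul_cancel_left] at h' ⊢
  exact h'

end HNNExtension

/-! ### The Baumslag–Solitar group -/

namespace BaumslagGersten

namespace H

theorem conj_x : (y⁻¹ * x * y : H) = x ^ 2 :=
  PresentedGroup.mk_eq_mk_of_mul_inv_mem (rels := relsH) (Set.mem_singleton _)

theorem conj_x_zpow (m : ℤ) : (y⁻¹ * x ^ m * y : H) = x ^ (2 * m) := by
  have := conj_zpow (i := m) (a := y⁻¹) (b := x)
  rw [inv_inv, conj_x] at this
  rw [← this, zpow_mul]
  simp

theorem conj_x_zpow_pow (m : ℤ) (j : ℕ) : ((y ^ j)⁻¹ * x ^ m * y ^ j : H) = x ^ (2 ^ j * m) := by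
  induction j with
  | zero => simp
  | succ j ih =>
    calc ((y ^ (j + 1))⁻¹ * x ^ m * y ^ (j + 1) : H)
        = y⁻¹ * ((y ^ j)⁻¹ * x ^ m * y ^ j) * y := by rw [pow_succ]; group
      _ = x ^ (2 ^ (j + 1) * m) := by rw [ih, conj_x_zpow]; congr 1; ring

theorem x_zpow_mul_y_pow (m : ℤ) (j : ℕ) : (x ^ m * y ^ j : H) = y ^ j * x ^ (2 ^ j * m) := by
  rw [← conj_x_zpow_pow]
  group

/-- The normal form (without uniqueness) of elements of `H`. -/
theorem exists_eq (h : H) : ∃ (i j : ℕ) (m : ℤ), h = y ^ i * x ^ m * (y ^ j)⁻¹ := by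
  -- the set of such elements contains `1` and is closed under left multiplication
  -- by the generators and their inverses
  have hx (n : ℤ) (h : H) (hh : ∃ (i j : ℕ) (m : ℤ), h = y ^ i * x ^ m * (y ^ j)⁻¹) :
      ∃ (i j : ℕ) (m : ℤ), x ^ n * h = y ^ i * x ^ m * (y ^ j)⁻¹ := by
    obtain ⟨i, j, m, rfl⟩ := hh
    refine ⟨i, j, 2 ^ i * n + m, ?_⟩
    rw [zpow_add, ← mul_assoc, ← mul_assoc, x_zpow_mul_y_pow]
    simp only [mul_assoc]
  have key : ∀ w : FreeGroup (Fin 2), ∀ h : H,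
      (∃ (i j : ℕ) (m : ℤ), h = y ^ i * x ^ m * (y ^ j)⁻¹) →
      ∃ (i j : ℕ) (m : ℤ), PresentedGroup.mk relsH w * h = y ^ i * x ^ m * (y ^ j)⁻¹ := by
    intro w
    induction w using FreeGroup.induction_on with
    | C1 => intro h hh; simpa using hh
    | of s =>
      intro h hh
      match s with
      | 0 =>
        have := hx 1 h hh
        rwa [zpow_one] at this
      | 1 =>
        obtain ⟨i, j, m, rfl⟩ := hh
        refine ⟨i + 1, j, m, ?_⟩
        change y * _ = _
        rw [pow_succ']
        simp only [mul_assoc]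
    | inv_of s _ =>
      intro h hh
      rw [map_inv]
      match s with
      | 0 =>
        have := hx (-1) h hh
        rwa [zpow_neg_one] at this
      | 1 =>
        obtain ⟨i, j, m, rfl⟩ := hh
        change ∃ (i' j' : ℕ) (m' : ℤ), y⁻¹ * _ = _
        rcases i with _ | i
        · refine ⟨0, j + 1, 2 * m, ?_⟩
          rw [← conj_x_zpow, pow_succ]
          group
        · refine ⟨i, j, m, ?_⟩
          rw [pow_succ']
          group
    | mul v w hv hw =>
      intro h hh
      rw [map_mul, mul_assoc]
      exact hv _ (hw h hh)
  obtain ⟨w, rfl⟩ := PresentedGroup.mk_surjective relsH h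
  simpa using key w 1 ⟨0, 0, 0, by simp⟩

/-- The action of `H` on `ℚ` by affine maps, with `x` acting as `r ↦ r + 1` and `y` as
`r ↦ r / 2`. -/
noncomputable def affine : H →* Equiv.Perm ℚ :=
  PresentedGroup.toGroup (rels := relsH)
    (f := ![Equiv.addRight 1, Equiv.mulRight₀ (1 / 2) (by norm_num)]) <| by
    intro r hr
    rw [Set.mem_singleton_iff.mp hr]
    ext q
    simp [conjBy, pow_two, Equiv.Perm.mul_apply]
    ring

/-- The exponent sum of `y`. -/
def expY : H →* Multiplicative ℤ :=
  PresentedGroup.toGroup (rels := relsH) (f := ![1, Multiplicative.ofAdd 1]) <| by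
    intro r hr
    rw [Set.mem_singleton_iff.mp hr]
    simp [conjBy]

/-- The exponent sum of `y` as an integer. -/
def deg (h : H) : ℤ := Multiplicative.toAdd (expY h)

@[simp] theorem deg_x : deg x = 0 := by
  simp [deg, expY, x, PresentedGroup.toGroup.of]

@[simp] theorem deg_y : deg y = 1 := by
  simp [deg, expY, y, PresentedGroup.toGroup.of]

@[simp] theorem deg_mul (g h : H) : deg (g * h) = deg g + deg h := by simp [deg]
@[simp] theorem deg_inv (h : H) : deg h⁻¹ = - deg h := by simp [deg]
@[simp] theorem deg_pow (h : H) (n : ℕ) : deg (h ^ n) = n * deg h := by simp [deg]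
@[simp] theorem deg_zpow (h : H) (n : ℤ) : deg (h ^ n) = n * deg h := by simp [deg]

theorem affine_x_zpow (m : ℤ) (q : ℚ) : affine (x ^ m) q = q + m := by
  have h1 (q : ℚ) : affine x q = q + 1 := by
    simp [affine, x, PresentedGroup.toGroup.of]
  induction m using Int.induction_on generalizing q with
  | zero => simp
  | succ n ih =>
    rw [zpow_add_one, map_mul, Equiv.Perm.mul_apply, ih, h1]
    push_cast
    ring
  | pred n ih =>
    rw [zpow_sub_one, map_mul, map_inv, Equiv.Perm.mul_apply, ih, Equiv.Perm.inv_def,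
      (Equiv.symm_apply_eq _).2 (show q = affine x (q - 1) by rw [h1]; ring)]
    push_cast
    ring

theorem x_zpow_injective : Function.Injective fun m : ℤ => (x ^ m : H) := by
  intro m n h
  have := congrArg (fun g => affine g 0) h
  simpa only [affine_x_zpow, zero_add, Int.cast_inj] using this

theorem y_zpow_injective : Function.Injective fun m : ℤ => (y ^ m : H) := by
  intro m n h
  simpa using congrArg deg h

theorem exists_eq_of_deg_eq_zero {h : H} (hh : deg h = 0) :
    ∃ (i : ℕ) (m : ℤ), h = y ^ i * x ^ m * (y ^ i)⁻¹ := by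
  obtain ⟨i, j, m, rfl⟩ := exists_eq h
  simp only [deg_mul, deg_pow, deg_y, deg_zpow, deg_x, deg_inv] at hh
  obtain rfl : i = j := by omega
  exact ⟨i, m, rfl⟩

/-- The centraliser of a nontrivial power of `y` is generated by `y`. -/
theorem eq_zpow_of_commute {h : H} {m : ℤ} (hm : m ≠ 0) (hc : Commute h (y ^ m)) :
    ∃ n : ℤ, h = y ^ n := by
  wlog hpos : 0 < m generalizing m
  · exact this (neg_ne_zero.2 hm) (by rw [zpow_neg]; exact hc.inv_right) (by omega)
  lift m to ℕ using hpos.le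
  rw [zpow_natCast] at hc
  obtain ⟨i, j, n, rfl⟩ := exists_eq h
  have hy (a b : ℕ) : Commute (y ^ a : H) (y ^ b) := Commute.pow_pow_self y a b
  have hx : Commute (x ^ n : H) (y ^ m) := by
    have := ((hy i m).inv_left.mul_left hc).mul_left (hy j m)
    simpa [mul_assoc] using this
  -- `x ^ n` commutes with `y ^ m`, whereas `y ^ m` conjugates it to `x ^ (2 ^ m * n)`
  have h2 : (x ^ n : H) = x ^ (2 ^ m * n) := by
    rw [← conj_x_zpow_pow, mul_assoc, hx.eq, inv_mul_cancel_left]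
  have h3 := x_zpow_injective h2
  have h4 : (2 : ℤ) ≤ 2 ^ m := by
    simpa using pow_le_pow_right₀ (a := (2 : ℤ)) one_le_two (show 1 ≤ m by omega)
  obtain rfl : n = 0 := by
    have : (2 ^ m - 1) * n = 0 := by linear_combination -h3
    rcases mul_eq_zero.1 this with h | h
    · omega
    · exact h
  exact ⟨i - j, by simp [zpow_sub]⟩

/-- If `a ^ b = a ^ 2` in `H` and `a` is nontrivial, then `a` has degree `0` and `b` is
conjugate to `y`. -/
theorem deg_eq_and_isConj_y {a b : H} (ha : a ≠ 1) (h : b⁻¹ * a * b = a ^ 2) :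
    deg a = 0 ∧ IsConj b y := by
  have hdeg : deg a = 0 := by
    have := congrArg deg h
    simp only [deg_mul, deg_inv, deg_pow] at this
    push_cast at this
    linarith
  refine ⟨hdeg, ?_⟩
  obtain ⟨i, m, rfl⟩ := exists_eq_of_deg_eq_zero hdeg
  have hm : m ≠ 0 := by
    rintro rfl
    simp at ha
  set c : H := (y ^ i)⁻¹ * b * y ^ i with hc
  have hbc : IsConj b c := isConj_iff.2 ⟨(y ^ i)⁻¹, by simp [hc]⟩
  have hcx : c⁻¹ * x ^ m * c = x ^ (2 * m) := by
    have : (x ^ (2 * m) : H) = (x ^ m) ^ 2 := by rw [mul_comm, zpow_mul]; norm_cast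
    rw [this, hc]
    have h' := congrArg (fun z => (y ^ i)⁻¹ * z * y ^ i) h
    simp only [pow_two] at h' ⊢
    simp only [mul_assoc, mul_inv_rev, inv_inv, inv_mul_cancel_left,
      inv_mul_cancel, mul_one] at h' ⊢
    exact h'
  obtain ⟨p, q, n, hpq⟩ := exists_eq c
  -- comparing exponents of `x` in `hcx` gives `2 ^ p * m = 2 ^ q * (2 * m)`, so `c` has degree `1`
  have h1 : (x ^ (2 ^ p * m) : H) = x ^ (2 ^ q * (2 * m)) := by
    rw [← conj_x_zpow_pow, ← conj_x_zpow_pow, ← hcx, hpq]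
    have hcomm : (x ^ n : H)⁻¹ * ((y ^ p)⁻¹ * x ^ m * y ^ p) * x ^ n =
        (y ^ p)⁻¹ * x ^ m * y ^ p := by
      rw [conj_x_zpow_pow, ← zpow_neg, ← zpow_add, ← zpow_add]
      congr 1
      ring
    rw [← hcomm]
    simp [mul_assoc]
  have h2 : (2 : ℤ) ^ p = 2 ^ (q + 1) := by
    have := x_zpow_injective h1
    refine mul_right_cancel₀ hm ?_
    rw [this]
    ring
  obtain rfl : p = q + 1 := by
    have h3 : (2 : ℕ) ^ p = 2 ^ (q + 1) := by exact_mod_cast h2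
    exact Nat.pow_right_injective le_rfl h3
  -- `c` is conjugate to `y * x ^ n = x ^ n * y * x ^ (-n)`
  refine hbc.trans (isConj_iff.2 ⟨x ^ (-n) * (y ^ q)⁻¹, ?_⟩)
  have h3 : (x ^ (-n) * y : H) = y * x ^ (2 * -n) := by
    simpa using x_zpow_mul_y_pow (-n) 1
  calc (x ^ (-n) * (y ^ q)⁻¹ * c * (x ^ (-n) * (y ^ q)⁻¹)⁻¹ : H)
      = x ^ (-n) * y * (x ^ n * x ^ n) := by
        rw [hpq, pow_succ]
        simp [mul_assoc]
    _ = y := by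
        rw [h3, mul_assoc, ← zpow_add, ← zpow_add]
        simp [two_mul]

end H

/-! ### Conjugation in the HNN extension -/

open H

/-- The subgroup `⟨y⟩` of `H`. -/
def subY : Subgroup H := (zpowersHom H H.y).range

/-- The subgroup `⟨x⟩` of `H`. -/
def subX : Subgroup H := (zpowersHom H H.x).range

theorem mem_subY {h : H} : h ∈ subY ↔ ∃ n : ℤ, H.y ^ n = h := Iff.rfl

theorem mem_subX {h : H} : h ∈ subX ↔ ∃ n : ℤ, H.x ^ n = h := Iff.rfl

theorem zpowersHom_x_injective : Function.Injective (zpowersHom H H.x) := x_zpow_injective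

theorem zpowersHom_y_injective : Function.Injective (zpowersHom H H.y) := y_zpow_injective

/-- The isomorphism `⟨y⟩ ≃ ⟨x⟩` with `y ↦ x`. -/
noncomputable def yx : subY ≃* subX :=
  (MonoidHom.ofInjective zpowersHom_y_injective).symm.trans
    (MonoidHom.ofInjective zpowersHom_x_injective)

theorem yx_apply (n : ℤ) : yx ⟨H.y ^ n, n, rfl⟩ = ⟨H.x ^ n, n, rfl⟩ :=
  congrArg (MonoidHom.ofInjective zpowersHom_x_injective)
    ((MonoidHom.ofInjective zpowersHom_y_injective).symm_apply_apply (Multiplicative.ofAdd n))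

theorem yx_symm_apply (n : ℤ) : yx.symm ⟨H.x ^ n, n, rfl⟩ = ⟨H.y ^ n, n, rfl⟩ := by
  rw [← yx_apply, MulEquiv.symm_apply_apply]

/-- `G` as an HNN extension of `H` with stable letter `t` conjugating `y` to `x`. -/
abbrev E : Type := HNNExtension H subY subX yx

namespace E

open HNNExtension

theorem t_mul_y_zpow (n : ℤ) : (t * of (H.y ^ n) : E) = of (H.x ^ n) * t := by
  have := t_mul_of (φ := yx) ⟨H.y ^ n, n, rfl⟩
  rwa [yx_apply] at this

theorem conj_x : (t⁻¹ * of H.x * t : E) = of H.y := by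
  have := t_mul_y_zpow 1
  rw [zpow_one, zpow_one] at this
  rw [mul_assoc, ← this, inv_mul_cancel_left]

/-- If `g` conjugates a nontrivial element `a` of `H` of degree zero into `H`, then `g` lies in `H`
or involves a single `t`. After a first letter `t` the conjugate of `a` is a power of `y`;
for a second stable letter, an element of `H` would have to conjugate this power of `y` into
`⟨x⟩`, which the degree forbids, or into `⟨y⟩`, and then the word is not reduced. -/
theorem exists_of_mul_eq {a a' : H} {g : E} (ha : a ≠ 1) (hdeg : deg a = 0)
    (h : of a * g = g * of a') :
    (∃ k, g = of k) ∨
      ∃ (k l : H) (m : ℤ), g = of k * t * of l ∧ k⁻¹ * a * k = H.x ^ m ∧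
        l⁻¹ * H.y ^ m * l = a' := by
  obtain ⟨k, L, hL, rfl⟩ := exists_reduced g
  rcases L with _ | ⟨⟨u, l⟩, M⟩
  · exact .inl ⟨k, by simp⟩
  right
  obtain ⟨⟨s, hs⟩, hks, hM⟩ := exists_of_mul_syl_eq hL h
  simp only at hks
  have hs1 : s ≠ 1 := by
    rintro rfl
    exact ha ((conj_eq_one_iff (a := k⁻¹)).1 (by rwa [inv_inv]))
  have hsdeg : deg s = 0 := by
    rw [← hks]
    simp [hdeg]
  rcases Int.units_eq_one_or u with rfl | rfl
  · obtain ⟨m, rfl⟩ := mem_subX.1 hs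
    have hm : m ≠ 0 := by
      rintro rfl
      simp at hs1
    have hφ : ((toSubgroupEquiv yx (-1) ⟨H.x ^ m, hs⟩ : toSubgroup subY subX (-(-1))) : H) =
        H.y ^ m := congrArg Subtype.val (yx_symm_apply m)
    rw [hφ] at hM
    rcases M with _ | ⟨⟨v, r⟩, N⟩
    · refine ⟨k, l, m, by simp [mul_assoc], hks, ?_⟩
      simp only [syl_nil, mul_one, ← map_mul] at hM
      rw [mul_assoc, of_injective (φ := yx) hM, inv_mul_cancel_left]
    exfalso
    obtain ⟨⟨s', hs'⟩, hls, -⟩ := exists_of_mul_syl_eq (List.isChain_cons.1 hL).2 hM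
    simp only at hls
    have hdeg' : deg s' = m := by
      rw [← hls]
      simp
    rcases Int.units_eq_one_or v with rfl | rfl
    · obtain ⟨n, rfl⟩ := mem_subX.1 hs'
      simp only [deg_zpow, deg_x, mul_zero] at hdeg'
      exact hm hdeg'.symm
    · obtain ⟨n, rfl⟩ := mem_subY.1 hs'
      obtain rfl : n = m := by simpa using hdeg'
      have hc : Commute l (H.y ^ n) := by
        rw [mul_assoc, inv_mul_eq_iff_eq_mul] at hls
        exact hls.symm
      obtain ⟨j, hj⟩ := eq_zpow_of_commute hm hc
      have := (List.isChain_cons_cons.1 hL).1 (mem_subY.2 ⟨j, hj.symm⟩)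
      exact absurd (show (1 : ℤˣ) = -1 from this) (by decide)
  · obtain ⟨n, rfl⟩ := mem_subY.1 hs
    simp only [deg_zpow, deg_y, mul_one] at hsdeg
    subst hsdeg
    simp at hs1

/-- If `a ^ b = a ^ 2` with `a` a nontrivial element of `H` of degree zero, then `b` lies in `H`. -/
theorem exists_of_eq_of_conj_eq_sq {a : H} {b : E} (ha : a ≠ 1) (hdeg : deg a = 0)
    (h : b⁻¹ * of a * b = of a ^ 2) : ∃ k, b = of k := by
  have h' : of a * b = b * of (a ^ 2) := by
    rw [map_pow, ← h]
    group
  refine (exists_of_mul_eq ha hdeg h').resolve_right ?_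
  rintro ⟨k, l, m, -, hk, hl⟩
  have := congrArg deg hl
  simp only [deg_mul, deg_inv, deg_zpow, deg_y, deg_pow, hdeg] at this
  obtain rfl : m = 0 := by linarith
  exact ha ((conj_eq_one_iff (a := k⁻¹)).1 (by rwa [inv_inv, ← zpow_zero H.x]))

/-- If `a ^ b = a ^ 2` and `a` is nontrivial, then some conjugation takes both `a` and `b`
into `H`. -/
theorem exists_conj_mem {a b : E} (ha : a ≠ 1) (h : b⁻¹ * a * b = a ^ 2) :
    ∃ (w : E) (k l : H), w * a * w⁻¹ = of k ∧ w * b * w⁻¹ = of l := by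
  -- it suffices to conjugate `a` to an element of `H` of degree zero
  suffices ∃ (w : E) (k : H), w * a * w⁻¹ = of k ∧ deg k = 0 by
    obtain ⟨w, k, hw, hk⟩ := this
    have hk1 : k ≠ 1 := by
      rintro rfl
      apply ha
      simpa using hw
    obtain ⟨l, hl⟩ := exists_of_eq_of_conj_eq_sq (b := w * b * w⁻¹) hk1 hk (by
      rw [← hw, conj_pow, ← h]
      group)
    exact ⟨w, k, l, hw, hl⟩
  obtain ⟨k, hk⟩ := exists_isConj_of_of_conj_eq_sq h
  obtain ⟨w, hw⟩ := isConj_iff.1 hk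
  by_cases hdeg : deg k = 0
  · exact ⟨w, k, hw, hdeg⟩
  obtain ⟨p, L, hL, hc⟩ := exists_reduced (w * b * w⁻¹)
  have hkc : (of k * (of p * syl yx L) : E) = of p * syl yx L * of (k ^ 2) := by
    rw [map_pow, ← hc, ← hw, conj_pow, ← h]
    group
  rcases L with _ | ⟨⟨u, l⟩, M⟩
  · simp only [syl_nil, mul_one, ← map_mul] at hkc
    have := congrArg deg (of_injective (φ := yx) hkc)
    simp only [deg_mul, deg_pow] at this
    push_cast at this
    exact absurd (by linarith) hdeg
  obtain ⟨⟨s, hs⟩, hps, -⟩ := exists_of_mul_syl_eq hL hkc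
  simp only at hps
  rcases Int.units_eq_one_or u with rfl | rfl
  · obtain ⟨m, rfl⟩ := mem_subX.1 hs
    have := congrArg deg hps
    simp only [deg_mul, deg_inv, deg_zpow, deg_x, mul_zero] at this
    exact absurd (by linarith) hdeg
  · obtain ⟨m, rfl⟩ := mem_subY.1 hs
    -- `k` is conjugate in `H` to a power of `y`, which `t` conjugates to a power of `x`
    refine ⟨t * (of p)⁻¹ * w, H.x ^ m, ?_, by simp⟩
    calc t * (of p)⁻¹ * w * a * (t * (of p)⁻¹ * w)⁻¹
        = t * ((of p)⁻¹ * (w * a * w⁻¹) * of p) * t⁻¹ := by group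
      _ = t * of (p⁻¹ * k * p) * t⁻¹ := by rw [hw]; simp
      _ = of (H.x ^ m) := by rw [hps, t_mul_y_zpow]; simp

/-- A triple satisfying the defining relations of `G`, with nontrivial first entry, is conjugate
to `x, y, g * t` for some `g` in the centraliser of `x`. -/
theorem exists_conj_eq {a b c : E} (ha : a ≠ 1) (h : b⁻¹ * a * b = a ^ 2)
    (hc : c⁻¹ * a * c = b) :
    ∃ (w : E) (g : H), g * H.x = H.x * g ∧ w * a * w⁻¹ = of H.x ∧ w * b * w⁻¹ = of H.y ∧
      w * c * w⁻¹ = of g * t := by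
  obtain ⟨w₁, k, l, hk, hl⟩ := exists_conj_mem ha h
  have hk1 : k ≠ 1 := by
    rintro rfl
    apply ha
    simpa using hk
  have hkl : l⁻¹ * k * l = k ^ 2 := by
    apply of_injective (φ := yx)
    rw [map_mul, map_mul, map_inv, map_pow, ← hk, ← hl, conj_pow, ← h]
    group
  obtain ⟨hdeg, hly⟩ := deg_eq_and_isConj_y hk1 hkl
  obtain ⟨v, hv⟩ := isConj_iff.1 hly
  -- conjugation by `w₂` takes `a` to an element `k'` of `H` and `b` to `y`
  set w₂ : E := of v * w₁ with hw₂
  set k' := v * k * v⁻¹ with hk'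
  have ha₂ : w₂ * a * w₂⁻¹ = of k' := by
    rw [hk', map_mul, map_mul, ← hk, hw₂, map_inv]
    group
  have hb₂ : w₂ * b * w₂⁻¹ = of H.y := by
    rw [← hv, map_mul, map_mul, ← hl, hw₂, map_inv]
    group
  have hk'1 : k' ≠ 1 := by
    intro h1
    rw [h1] at ha₂
    apply ha
    simpa using ha₂
  have hk'deg : deg k' = 0 := by simp [hk', hdeg]
  have hc₂ : of k' * (w₂ * c * w₂⁻¹) = w₂ * c * w₂⁻¹ * of H.y := by
    rw [← ha₂, ← hb₂, ← hc]
    group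
  rcases exists_of_mul_eq hk'1 hk'deg hc₂ with ⟨p, hp⟩ | ⟨p, q, m, hpq, hpx, hqy⟩
  · rw [hp, ← map_mul, ← map_mul] at hc₂
    have := congrArg deg (of_injective (φ := yx) hc₂)
    simp only [deg_mul, deg_y] at this
    omega
  obtain rfl : m = 1 := by simpa using congrArg deg hqy
  rw [zpow_one] at hpx hqy
  obtain ⟨n, rfl⟩ : ∃ n : ℤ, q = H.y ^ n := by
    refine eq_zpow_of_commute (m := 1) one_ne_zero ?_
    rw [zpow_one, commute_iff_eq]
    rw [mul_assoc, inv_mul_eq_iff_eq_mul] at hqy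
    exact hqy.symm
  -- `k'` is conjugate to `x` by `p`, hence already by a power of `y`
  obtain ⟨i, j, r, hp⟩ := exists_eq p
  have hk'x : k' = H.y ^ (i - j : ℤ) * H.x * (H.y ^ (i - j : ℤ))⁻¹ := by
    have h1 : H.x ^ r * ((H.y ^ j)⁻¹ * H.x ^ (1 : ℤ) * H.y ^ j) * (H.x ^ r)⁻¹ =
        (H.y ^ j)⁻¹ * H.x ^ (1 : ℤ) * H.y ^ j := by
      rw [conj_x_zpow_pow, ← zpow_neg, ← zpow_add, ← zpow_add]
      congr 1
      ring
    have h2 : k' = p * H.x * p⁻¹ := by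
      rw [← hpx]
      group
    rw [zpow_one] at h1
    calc k' = H.y ^ i * (H.x ^ r * ((H.y ^ j)⁻¹ * H.x * H.y ^ j) * (H.x ^ r)⁻¹) * (H.y ^ i)⁻¹ := by
          rw [h2, hp]
          group
      _ = _ := by
          rw [h1]
          group
  set e : ℤ := i - j with he
  have haw : (of (H.y ^ e))⁻¹ * w₂ * a * ((of (H.y ^ e))⁻¹ * w₂)⁻¹ = of H.x := by
    calc (of (H.y ^ e))⁻¹ * w₂ * a * ((of (H.y ^ e))⁻¹ * w₂)⁻¹
        = (of (H.y ^ e))⁻¹ * (w₂ * a * w₂⁻¹) * of (H.y ^ e) := by group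
      _ = of H.x := by
        rw [ha₂, hk'x]
        simp [mul_assoc]
  have hbw : (of (H.y ^ e))⁻¹ * w₂ * b * ((of (H.y ^ e))⁻¹ * w₂)⁻¹ = of H.y := by
    calc (of (H.y ^ e))⁻¹ * w₂ * b * ((of (H.y ^ e))⁻¹ * w₂)⁻¹
        = (of (H.y ^ e))⁻¹ * (w₂ * b * w₂⁻¹) * of (H.y ^ e) := by group
      _ = of H.y := by
        rw [hb₂, map_zpow]
        group
  have hcw : (of (H.y ^ e))⁻¹ * w₂ * c * ((of (H.y ^ e))⁻¹ * w₂)⁻¹ =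
      of (H.y ^ (-e) * p * H.x ^ (n + e)) * t := by
    calc (of (H.y ^ e))⁻¹ * w₂ * c * ((of (H.y ^ e))⁻¹ * w₂)⁻¹
        = (of (H.y ^ e))⁻¹ * (w₂ * c * w₂⁻¹) * of (H.y ^ e) := by group
      _ = of (H.y ^ (-e) * p) * (t * of (H.y ^ (n + e))) := by
        rw [hpq, zpow_add, zpow_neg]
        simp [mul_assoc]
      _ = _ := by rw [t_mul_y_zpow, map_mul _ (H.y ^ (-e) * p), mul_assoc]
  refine ⟨(of (H.y ^ e))⁻¹ * w₂, H.y ^ (-e) * p * H.x ^ (n + e), ?_, haw, hbw, hcw⟩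
  -- both `g * t` and `t` conjugate `x` to `y`, so `g` commutes with `x`
  generalize H.y ^ (-e) * p * H.x ^ (n + e) = g at hcw
  generalize (of (H.y ^ e))⁻¹ * w₂ = w at haw hbw hcw
  apply of_injective (φ := yx)
  have h1 : (w * c * w⁻¹)⁻¹ * (w * a * w⁻¹) * (w * c * w⁻¹) = w * b * w⁻¹ := by
    rw [← hc]
    group
  rw [haw, hbw, hcw, ← conj_x] at h1
  have h2 := congrArg (fun z => of g * t * z * t⁻¹) h1
  simp only [map_mul]
  simpa [mul_assoc] using h2.symm

end E

/-! ### The Baumslag–Gersten group as an HNN extension -/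

namespace G

theorem conj_t_x : (t⁻¹ * x * t : G) = y :=
  PresentedGroup.mk_eq_mk_of_mul_inv_mem (rels := relsG) (Set.mem_insert_of_mem _ rfl)

theorem conj_y_x : (y⁻¹ * x * y : G) = x ^ 2 := conjBy_x_y

theorem lift_relsG {K : Type*} [Group K] {a b c : K} (h : b⁻¹ * a * b = a ^ 2)
    (hc : c⁻¹ * a * c = b) : ∀ r ∈ relsG, FreeGroup.lift ![a, b, c] r = 1 := by
  rintro r (rfl | rfl)
  · simp [conjBy, h]
  · simp [conjBy, hc]

/-- The homomorphism from `G` determined by a triple satisfying the defining relations. -/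
def homOf {K : Type*} [Group K] {a b c : K} (h : b⁻¹ * a * b = a ^ 2)
    (hc : c⁻¹ * a * c = b) : G →* K :=
  PresentedGroup.toGroup (lift_relsG h hc)

section
variable {K : Type*} [Group K] {a b c : K} (h : b⁻¹ * a * b = a ^ 2) (hc : c⁻¹ * a * c = b)

@[simp] theorem homOf_x : homOf h hc x = a := PresentedGroup.toGroup.of (lift_relsG h hc)
@[simp] theorem homOf_y : homOf h hc y = b := PresentedGroup.toGroup.of (lift_relsG h hc)
@[simp] theorem homOf_t : homOf h hc t = c := PresentedGroup.toGroup.of (lift_relsG h hc)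

end

theorem hom_ext {K : Type*} [Group K] {f g : G →* K} (hx : f x = g x) (hy : f y = g y)
    (ht : f t = g t) : f = g :=
  PresentedGroup.ext fun i => match i with
    | 0 => hx
    | 1 => hy
    | 2 => ht

/-- The homomorphism from `G` to the HNN extension. -/
noncomputable def toE : G →* E :=
  homOf (a := HNNExtension.of H.x) (b := HNNExtension.of H.y) (c := HNNExtension.t)
    (by simp only [← map_inv, ← map_mul, H.conj_x, map_pow]) E.conj_x

@[simp] theorem toE_x : toE x = HNNExtension.of H.x := homOf_x _ _
@[simp] theorem toE_y : toE y = HNNExtension.of H.y := homOf_y _ _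
@[simp] theorem toE_t : toE t = HNNExtension.t := homOf_t _ _

/-- The homomorphism from the HNN extension to `G`. -/
noncomputable def ofE : E →* G :=
  HNNExtension.lift incl t <| by
    rintro ⟨_, n, rfl⟩
    have h1 : yx ⟨zpowersHom H H.y n, n, rfl⟩ = ⟨H.x ^ n.toAdd, n, rfl⟩ := yx_apply n.toAdd
    rw [h1]
    simp only [zpowersHom_apply, map_zpow, incl_x, incl_y, ← conj_t_x]
    have := conj_zpow (i := n.toAdd) (a := t⁻¹) (b := x)
    rw [inv_inv] at this
    rw [this]
    group

theorem hom_ext_H {K : Type*} [Group K] {f g : H →* K} (hx : f H.x = g H.x)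
    (hy : f H.y = g H.y) : f = g :=
  PresentedGroup.ext fun i => match i with
    | 0 => hx
    | 1 => hy

/-- `G` is the HNN extension of `H` in which `t` conjugates `y` to `x`. -/
noncomputable def equivE : G ≃* E :=
  MonoidHom.toMulEquiv toE ofE
    (hom_ext (by simp [ofE, incl_x]) (by simp [ofE, incl_y]) (by simp [ofE]))
    (HNNExtension.hom_ext
      (hom_ext_H (by simp [ofE, incl_x]) (by simp [ofE, incl_y])) (by simp [ofE]))

theorem equivE_x : equivE x = HNNExtension.of H.x := toE_x
theorem equivE_t : equivE t = HNNExtension.t := toE_t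
theorem equivE_y : equivE y = HNNExtension.of H.y := toE_y

theorem equivE_incl (h : H) : equivE (incl h) = HNNExtension.of h :=
  DFunLike.congr_fun (f := (equivE : G →* E).comp incl) (g := HNNExtension.of)
    (hom_ext_H (by simp [incl_x, equivE_x]) (by simp [incl_y, equivE_y])) h

theorem exists_conj_eq {a b c : G} (ha : a ≠ 1) (h : b⁻¹ * a * b = a ^ 2)
    (hc : c⁻¹ * a * c = b) :
    ∃ (w : G) (g : H), g * H.x = H.x * g ∧ w * a * w⁻¹ = x ∧ w * b * w⁻¹ = y ∧
      w * c * w⁻¹ = incl g * t := by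
  obtain ⟨w, g, hg, h1, h2, h3⟩ := E.exists_conj_eq (a := equivE a) (b := equivE b)
    (c := equivE c) (by simpa using ha) (by simp only [← map_inv, ← map_mul, h, map_pow])
    (by simp only [← map_inv, ← map_mul, hc])
  refine ⟨equivE.symm w, g, hg, ?_, ?_, ?_⟩ <;> apply equivE.injective
  · simpa [equivE_x] using h1
  · simpa [equivE_y] using h2
  · simpa [equivE_t, equivE_incl] using h3

/-- An endomorphism fixing `x` and `y` and taking `t` to `g * t`, with `g` in the centraliser of
`x` in `H`, is inverse to the one taking `t` to `g⁻¹ * t`. -/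
theorem bijective_of_eq {f : G →* G} {g : H} (hg : g * H.x = H.x * g) (hx : f x = x)
    (hy : f y = y) (ht : f t = incl g * t) : Function.Bijective f := by
  have hgx : incl g * x = x * incl g := by
    rw [← incl_x, ← map_mul, hg, map_mul]
  have hconj : (incl g⁻¹ * t)⁻¹ * x * (incl g⁻¹ * t) = y := by
    calc (incl g⁻¹ * t)⁻¹ * x * (incl g⁻¹ * t)
        = t⁻¹ * (incl g * x) * (incl g)⁻¹ * t := by rw [map_inv]; group
      _ = y := by rw [hgx, ← conj_t_x]; group
  set f' : G →* G := homOf conj_y_x hconj with hf'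
  have hfi (h : H) : f (incl h) = incl h :=
    DFunLike.congr_fun (f := f.comp incl) (g := incl)
      (hom_ext_H (by simp [incl_x, hx]) (by simp [incl_y, hy])) h
  have hfi' (h : H) : f' (incl h) = incl h :=
    DFunLike.congr_fun (f := f'.comp incl) (g := incl)
      (hom_ext_H (by simp [incl_x, hf']) (by simp [incl_y, hf'])) h
  have h1 : f.comp f' = MonoidHom.id G :=
    hom_ext (by simp [hf', hx]) (by simp [hf', hy]) (by
      rw [MonoidHom.comp_apply, hf', homOf_t, map_mul, hfi, ht, map_inv]
      simp)
  have h2 : f'.comp f = MonoidHom.id G :=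
    hom_ext (by simp [hf', hx]) (by simp [hf', hy]) (by
      rw [MonoidHom.comp_apply, ht, map_mul, hfi', hf', homOf_t, map_inv]
      simp)
  exact Function.bijective_iff_has_inverse.2
    ⟨f', DFunLike.congr_fun h2, DFunLike.congr_fun h1⟩

end G

end BaumslagGersten

/-! ### Endomorphisms -/

open BaumslagGersten in
theorem mainTheorem2 :
    (∀ F : G →* G, F G.x = 1 → F G.y = 1) ∧
    (∀ w : G, ∃ F : G →* G, F G.x = 1 ∧ F G.y = 1 ∧ F G.t = w) ∧
    (∀ F : G →* G, F G.x ≠ 1 →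
      Function.Bijective F ∧
      ∃ A : MulAut G, A ∈ (MulAut.conj : G →* MulAut G).range ∧
        A (F G.x) = G.x ∧ A (F G.y) = G.y ∧
        ∃ g ∈ Subgroup.centralizer ({H.x} : Set H), A (F G.t) = incl g * G.t) := by
  refine ⟨fun F hF => ?_, fun w => ?_, fun F hF => ?_⟩
  · rw [← G.conj_t_x, map_mul, map_mul, map_inv, hF]
    simp
  · exact ⟨G.homOf (a := 1) (b := 1) (c := w) (by simp) (by simp), by simp, by simp, by simp⟩
  · obtain ⟨w, g, hg, hx, hy, ht⟩ := G.exists_conj_eq (b := F G.y) (c := F G.t) hF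
      (by rw [← map_inv, ← map_mul, ← map_mul, G.conj_y_x, map_pow])
      (by rw [← map_inv, ← map_mul, ← map_mul, G.conj_t_x])
    have hA := G.bijective_of_eq (f := (MulAut.conj w : G →* G).comp F) hg hx hy ht
    refine ⟨?_, MulAut.conj w, ⟨w, rfl⟩, hx, hy, g,
      Subgroup.mem_centralizer_singleton_iff.2 hg, ht⟩
    exact (Function.Bijective.of_comp_iff' (MulAut.conj w).bijective F).1 hA
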